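/- Let $\mathcal X=(\mathcal X_1,\mathcal X_2,\mu,\partial)$ be a finite crossed module: $\mathcal X_1,\mathcal X_2$ are finite groups, $\mathcal X_1$ acts on $\mathcal X_2$ on the right by automorphisms, written $m\mapsto m^g$, and $\partial:\mathcal X_2\to\mathcal X_1$ is a homomorphism with $\partial(m^g)=g^{-1}(\partial m)g$ and $m^{\partial n}=n^{-1}mn$. Put $K=\ker\partial$, $I=\operatorname{im}\partial$, $C=\mathcal X_1/I$, $|\mathcal X|=|\mathcal X_2||C|$ and $D=|C||K|$. Consider triples $(V,P,Q)$ with $V$ a finite-dimensional complex vector space, $P:\mathcal X_2\to\operatorname{End}(V)$ and $Q:\mathcal X_1\to GL(V)$ with $P(m)P(n)=\delta(m,n)P(m)$, $\sum_m P(m)=\mathrm{id}_V$, $Q(g)Q(h)=Q(gh)$ and $P(m)Q(g)=Q(g)P(m^g)$. Morphisms are the linear maps commuting with all $P(m)$ and $Q(g)$; direct sums are formed componentwise; a triple is irreducible if $V\neq 0$ and no subspace other than $0$ and $V$ is stable under all $P(m)$ and $Q(g)$. Let $\operatorname{Irr}(\mathcal X)$ be the set of isomorphism classes of irreducible triples.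 For $p\in\operatorname{Irr}(\mathcal X)$ let $d_p=\dim V$, $\psi_p(m,g)=\operatorname{Tr}_V(P(m)Q(g))$ and $\omega_p=\frac1{d_p}\sum_{m}\psi_p(m,\partial m)$, and for $p,q\in\operatorname{Irr}(\mathcal X)$ let $$S_{pq}=\frac1{|\mathcal X|}\sum_{m,n\in\mathcal X_2}\overline{\psi_p(m,\partial n)\,\psi_q(n,\partial m)} .$$ Let $\mathbf 1\in\operatorname{Irr}(\mathcal X)$ be the class of the trivial object $V=\mathbb C$, $P(m)=\delta(m,1)\,\mathrm{id}$, $Q(g)=\mathrm{id}$. The vacuum object $\mathbf 0$ is the space of functions $\phi:K\times C\to\mathbb C$ with $(P(m)\phi)(x,Iy)=\delta(m,x^y)\phi(x,Iy)$ and $(Q(g)\phi)(x,Iy)=\phi(x,Iyg)$. Then $\operatorname{Irr}(\mathcal X)$ is finite, $\dim\mathbf 0=D$, and $\mathbf 0$ is isomorphic to a finite direct sum of irreducible objects, in which the number $\mu_p$ of summands in the class $p$ does not depend on the decomposition. For every $p\in\operatorname{Irr}(\mathcal X)$: 1. $\mu_p=D\,[S^2]_{\mathbf 1p}$; 2. $\mu_p>0$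 if and only if $p$ is transparent, i.e. there is $\alpha\in\mathbb C$ with $S_{pq}=\alpha S_{\mathbf 1q}$ for all $q\in\operatorname{Irr}(\mathcal X)$; 3. whenever $S_{pq}=\alpha S_{\mathbf 1q}$ for all $q\in\operatorname{Irr}(\mathcal X)$, one has $\alpha=\mu_p=d_p$ and $\omega_p=1$. Thus the transparent irreducibles are exactly the irreducible constituents of $\mathbf 0$ (those isomorphic to a subobject of $\mathbf 0$), and Bruguières' modularizability condition holds: $S_{pq}=\alpha S_{\mathbf 1q}$ for all $q$ implies $\omega_p=1$ and $\alpha=d_p$. -/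

import Mathlib

open scoped ComplexConjugate

universe u v w w'

/-- A crossed module with base group `G` and top group `M`: a (right) action `m ↦ m ^ g` of `G` on
`M` by automorphisms and a boundary homomorphism `∂ : M → G`, satisfying
`∂ (m ^ g) = g⁻¹ (∂ m) g` and `m ^ (∂ n) = n⁻¹ m n`. -/
structure CrossedModule (G : Type u) (M : Type v) [Group G] [Group M] where
  /-- `act m g` is `m ^ g`. -/
  act : M → G → M
  bd : M →* G
  mul_act : ∀ m n g, act (m * n) g = act m g * act n g
  act_one : ∀ m, act m 1 = m
  act_mul : ∀ m g h, act m (g * h) = act (act m g) h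
  bd_act : ∀ m g, bd (act m g) = g⁻¹ * bd m * g
  act_bd : ∀ m n, act m (bd n) = n⁻¹ * m * n

namespace CrossedModule

variable {G : Type u} {M : Type v} [Group G] [Group M]

/-- `K = ker ∂`. -/
abbrev K (X : CrossedModule G M) : Subgroup M := X.bd.ker

/-- `I = im ∂`. -/
abbrev I (X : CrossedModule G M) : Subgroup G := X.bd.range

/-- `C = coker ∂ = G / I`. As `I` is normal, left and right cosets agree. -/
abbrev C (X : CrossedModule G M) : Type u := G ⧸ X.I

instance I_normal (X : CrossedModule G M) : X.I.Normal where
  conj_mem := by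
    rintro _ ⟨m, rfl⟩ g
    exact ⟨X.act m g⁻¹, by simp [X.bd_act]⟩

theorem act_bd_of_mem_K (X : CrossedModule G M) {k : M} (hk : k ∈ X.K) (n : M) :
    X.act k (X.bd n) = k := by
  have h := X.act_bd n k
  rw [MonoidHom.mem_ker.mp hk, X.act_one] at h
  have h2 : k * n = n * k := by
    conv_lhs => rw [h]
    group
  rw [X.act_bd, mul_assoc, h2, inv_mul_cancel_left]

theorem act_mem_K (X : CrossedModule G M) {k : M} (hk : k ∈ X.K) (g : G) : X.act k g ∈ X.K := by
  rw [MonoidHom.mem_ker, X.bd_act, MonoidHom.mem_ker.mp hk]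
  simp

/-- The action of `C` on `K` induced by the action of `G` on `M`: `actC x (I y) = x ^ y`. -/
def actC (X : CrossedModule G M) (x : X.K) : X.C → M :=
  Quotient.lift (fun y : G => X.act x y) (by
    intro a b hab
    obtain ⟨n, hn⟩ := QuotientGroup.leftRel_apply.mp hab
    have hb : b = a * X.bd n := by rw [hn, mul_inv_cancel_left]
    change X.act x a = X.act x b
    rw [hb, X.act_mul, X.act_bd_of_mem_K (X.act_mem_K x.2 a)])

theorem actC_mk (X : CrossedModule G M) (x : X.K) (y : G) :
    X.actC x (y : X.C) = X.act x y := rfl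

theorem act_injective (X : CrossedModule G M) (g : G) : Function.Injective fun m => X.act m g := by
  intro m n h
  have h' : X.act (X.act m g) g⁻¹ = X.act (X.act n g) g⁻¹ := congrArg (fun t => X.act t g⁻¹) h
  rwa [← X.act_mul, ← X.act_mul, mul_inv_cancel, X.act_one, X.act_one] at h'

theorem actC_mul (X : CrossedModule G M) (x : X.K) (c : X.C) (g : G) :
    X.actC x (c * (g : X.C)) = X.act (X.actC x c) g := by
  induction c using QuotientGroup.induction_on with
  | H y => exact X.act_mul x y g

open scoped Classical in
/-- An object `(V, P, Q)` of the category associated to `X`: a (finite dimensional) complex vector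
space with maps `P : M → End V`, `Q : G → GL(V)` such that `P(m)P(n) = δ(m,n) P(m)`,
`∑ₘ P(m) = id`, `Q(g)Q(h) = Q(gh)` and `P(m)Q(g) = Q(g)P(m ^ g)`. A multiplicative map
`Q : G → GL(V)` is the same as a representation of `G` on `V`. -/
structure Obj [Fintype M] (X : CrossedModule G M) where
  V : Type w
  [addCommGroup : AddCommGroup V]
  [module : Module ℂ V]
  [finiteDimensional : FiniteDimensional ℂ V]
  P : M → Module.End ℂ V
  Q : Representation ℂ G V
  P_mul_P : ∀ m n, P m * P n = if m = n then P m else 0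
  sum_P : ∑ m, P m = 1
  P_mul_Q : ∀ m g, P m * Q g = Q g * P (X.act m g)

attribute [instance] Obj.addCommGroup Obj.module Obj.finiteDimensional

variable [Fintype M] {X : CrossedModule G M}

namespace Obj

/-- Morphisms: linear maps commuting with all `P(m)` and all `Q(g)`. -/
def IsMorphism (A : Obj.{u, v, w} X) (B : Obj.{u, v, w'} X) (f : A.V →ₗ[ℂ] B.V) : Prop :=
  (∀ m, f ∘ₗ A.P m = B.P m ∘ₗ f) ∧ (∀ g, f ∘ₗ A.Q g = B.Q g ∘ₗ f)

/-- Two objects are isomorphic if there is a bijective morphism between them. -/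
def Isomorphic (A : Obj.{u, v, w} X) (B : Obj.{u, v, w'} X) : Prop :=
  ∃ f : A.V ≃ₗ[ℂ] B.V, IsMorphism A B f.toLinearMap

theorem Isomorphic.refl (A : Obj.{u, v, w} X) : A.Isomorphic A :=
  ⟨LinearEquiv.refl ℂ A.V, fun _ => rfl, fun _ => rfl⟩

theorem Isomorphic.symm {A : Obj.{u, v, w} X} {B : Obj.{u, v, w'} X} (h : A.Isomorphic B) :
    B.Isomorphic A := by
  obtain ⟨f, hP, hQ⟩ := h
  refine ⟨f.symm, fun m => ?_, fun g => ?_⟩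
  · ext x
    have := LinearMap.congr_fun (hP m) (f.symm x)
    simp at this
    simp [← this]
  · ext x
    have := LinearMap.congr_fun (hQ g) (f.symm x)
    simp at this
    simp [← this]

theorem Isomorphic.trans {A B D : Obj.{u, v, w} X} (h : A.Isomorphic B) (h' : B.Isomorphic D) :
    A.Isomorphic D := by
  obtain ⟨f, hP, hQ⟩ := h
  obtain ⟨f', hP', hQ'⟩ := h'
  refine ⟨f.trans f', fun m => ?_, fun g => ?_⟩
  · ext x
    have h1 := LinearMap.congr_fun (hP m) x
    have h2 := LinearMap.congr_fun (hP' m) (f x)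
    simp at h1 h2
    simp [h1, h2]
  · ext x
    have h1 := LinearMap.congr_fun (hQ g) x
    have h2 := LinearMap.congr_fun (hQ' g) (f x)
    simp at h1 h2
    simp [h1, h2]

/-- A subspace is invariant if it is stable under all `P(m)` and all `Q(g)`. -/
def IsInvariant (A : Obj.{u, v, w} X) (W : Submodule ℂ A.V) : Prop :=
  (∀ m, ∀ x ∈ W, A.P m x ∈ W) ∧ (∀ g, ∀ x ∈ W, A.Q g x ∈ W)

/-- An object is irreducible if it is nonzero and has no nontrivial invariant subspace. -/
def IsIrreducible (A : Obj.{u, v, w} X) : Prop :=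
  Nontrivial A.V ∧ ∀ W : Submodule ℂ A.V, A.IsInvariant W → W = ⊥ ∨ W = ⊤

/-- The dimension of an object. -/
noncomputable def dim (A : Obj.{u, v, w} X) : ℕ := Module.finrank ℂ A.V

/-- The character `ψ(m,g) = Tr (P(m) Q(g))`. -/
noncomputable def character (A : Obj.{u, v, w} X) (m : M) (g : G) : ℂ :=
  LinearMap.trace ℂ A.V (A.P m * A.Q g)

theorem Isomorphic.dim_eq {A : Obj.{u, v, w} X} {B : Obj.{u, v, w'} X} (h : A.Isomorphic B) :
    A.dim = B.dim := by
  obtain ⟨f, -⟩ := h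
  exact f.finrank_eq

theorem Isomorphic.character_eq {A : Obj.{u, v, w} X} {B : Obj.{u, v, w'} X}
    (h : A.Isomorphic B) : A.character = B.character := by
  obtain ⟨f, hP, hQ⟩ := h
  funext m g
  have key : B.P m * B.Q g = f.conj (A.P m * A.Q g) := by
    ext x
    have h1 := LinearMap.congr_fun (hP m) (A.Q g (f.symm x))
    have h2 := LinearMap.congr_fun (hQ g) (f.symm x)
    simp at h1 h2
    simp [LinearEquiv.conj_apply, h1, h2]
  rw [character, character, key, LinearMap.trace_conj']

/-- The direct sum of a finite family of objects. -/
def directSum {ι : Type w'} [Fintype ι] (A : ι → Obj.{u, v, w} X) : Obj.{u, v, max w w'} X where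
  V := ∀ i, (A i).V
  P m := LinearMap.pi fun i => (A i).P m ∘ₗ LinearMap.proj i
  Q :=
    { toFun := fun g => LinearMap.pi fun i => (A i).Q g ∘ₗ LinearMap.proj i
      map_one' := by
        ext x i
        simp
      map_mul' := by
        intro g h
        refine LinearMap.ext fun x => funext fun i => ?_
        simp }
  P_mul_P m n := by
    refine LinearMap.ext fun x => funext fun i => ?_
    have := LinearMap.congr_fun ((A i).P_mul_P m n) (x i)
    split_ifs at this ⊢ <;> simpa using this
  sum_P := by
    refine LinearMap.ext fun x => funext fun i => ?_
    have := LinearMap.congr_fun (A i).sum_P (x i)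
    simpa [LinearMap.sum_apply] using this
  P_mul_Q m g := by
    refine LinearMap.ext fun x => funext fun i => ?_
    have := LinearMap.congr_fun ((A i).P_mul_Q m g) (x i)
    simpa using this

end Obj

open scoped Classical in
/-- The trivial object: `V = ℂ`, `P(m) = δ(m,1) id`, `Q(g) = id`. -/
noncomputable def trivialObj (X : CrossedModule G M) : Obj.{u, v, 0} X where
  V := ℂ
  P m := if m = 1 then 1 else 0
  Q := 1
  P_mul_P m n := by
    by_cases h : m = 1 <;> by_cases h' : n = 1 <;> simp [h, h', eq_comm]
  sum_P := by simp
  P_mul_Q m g := by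
    have : X.act m g = 1 ↔ m = 1 := by
      constructor
      · intro h
        have h1 : X.act 1 g = 1 := by
          have := X.mul_act 1 1 g
          simpa using this
        exact X.act_injective g (h.trans h1.symm)
      · rintro rfl
        have := X.mul_act 1 1 g
        simpa using this
    simp [this]

theorem trivialObj_isIrreducible (X : CrossedModule G M) : X.trivialObj.IsIrreducible :=
  ⟨inferInstanceAs (Nontrivial ℂ), fun W _ =>
    eq_bot_or_eq_top (α := Submodule ℂ ℂ) W⟩

open scoped Classical in
/-- The vacuum object: `V` is the space of functions `K × C → ℂ`, with
`(P(m) φ)(x, I y) = δ(m, x ^ y) φ(x, I y)` and `(Q(g) φ)(x, I y) = φ(x, I y g)`. -/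
noncomputable def vacuum [Fintype G] (X : CrossedModule G M) : Obj.{u, v, max u v} X where
  V := X.K × X.C → ℂ
  P m :=
    { toFun := fun φ z => if m = X.actC z.1 z.2 then φ z else 0
      map_add' := by
        intro φ φ'
        funext z
        by_cases h : m = X.actC z.1 z.2 <;> simp [h]
      map_smul' := by
        intro c φ
        funext z
        by_cases h : m = X.actC z.1 z.2 <;> simp [h] }
  Q :=
    { toFun := fun g =>
        { toFun := fun φ z => φ (z.1, z.2 * (g : X.C))
          map_add' := fun _ _ => rfl
          map_smul' := fun _ _ => rfl }
      map_one' := by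
        refine LinearMap.ext fun φ => funext fun z => ?_
        simp
      map_mul' := by
        intro g h
        refine LinearMap.ext fun φ => funext fun z => ?_
        simp [mul_assoc] }
  P_mul_P m n := by
    refine LinearMap.ext fun φ => funext fun z => ?_
    by_cases h : m = n
    · subst h
      by_cases h' : m = X.actC z.1 z.2 <;> simp [h']
    · by_cases h' : m = X.actC z.1 z.2
      · have : ¬ n = X.actC z.1 z.2 := fun h2 => h (h'.trans h2.symm)
        simp [h, this]
      · simp [h, h']
  sum_P := by
    refine LinearMap.ext fun φ => funext fun z => ?_
    simp [LinearMap.sum_apply]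
  P_mul_Q m g := by
    refine LinearMap.ext fun φ => funext fun z => ?_
    have : X.act m g = X.actC z.1 (z.2 * (g : X.C)) ↔ m = X.actC z.1 z.2 := by
      rw [X.actC_mul]
      exact (X.act_injective g).eq_iff
    simp [this]

/-- The setoid of isomorphism of irreducible objects. Every finite dimensional space is isomorphic
to one in `Type`, so it suffices to consider objects with `V : Type`. -/
instance irrSetoid (X : CrossedModule G M) : Setoid {A : Obj.{u, v, 0} X // A.IsIrreducible} where
  r A B := A.1.Isomorphic B.1
  iseqv := ⟨fun A => .refl A.1, fun h => h.symm, fun h h' => h.trans h'⟩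

/-- `Irr(X)`: the isomorphism classes of irreducible objects. -/
def Irr (X : CrossedModule G M) := Quotient X.irrSetoid

namespace Irr

/-- The isomorphism class of an irreducible object. -/
def mk (A : Obj.{u, v, 0} X) (hA : A.IsIrreducible) : X.Irr :=
  Quotient.mk X.irrSetoid ⟨A, hA⟩

/-- The class of the trivial object. -/
noncomputable def one (X : CrossedModule G M) : X.Irr :=
  mk X.trivialObj X.trivialObj_isIrreducible

/-- The character `ψ_p`. -/
noncomputable def ψ (p : X.Irr) : M → G → ℂ :=
  Quotient.lift (fun A : {A : Obj.{u, v, 0} X // A.IsIrreducible} => A.1.character)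
    (fun _ _ h => Obj.Isomorphic.character_eq h) p

/-- The dimension `d_p`. -/
noncomputable def d (p : X.Irr) : ℕ :=
  Quotient.lift (fun A : {A : Obj.{u, v, 0} X // A.IsIrreducible} => A.1.dim)
    (fun _ _ h => Obj.Isomorphic.dim_eq h) p

/-- `ω_p = (1/d_p) ∑ₘ ψ_p(m, ∂m)`. -/
noncomputable def ω (p : X.Irr) : ℂ := (1 / (p.d : ℂ)) * ∑ m : M, p.ψ m (X.bd m)

/-- `p` is an irreducible constituent of `A`: a representative of `p` embeds in `A`. -/
def IsConstituent (p : X.Irr) (A : Obj.{u, v, w} X) : Prop :=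
  ∃ (B : Obj.{u, v, 0} X) (hB : B.IsIrreducible), mk B hB = p ∧
    ∃ f : B.V →ₗ[ℂ] A.V, Obj.IsMorphism B A f ∧ Function.Injective f

/-- `p` occurs with multiplicity `k` in `A`: there is an isomorphism of `A` with a finite direct sum
of irreducible objects of which exactly `k` belong to the class `p`. -/
def OccursTimes (p : X.Irr) (A : Obj.{u, v, w} X) (k : ℕ) : Prop :=
  ∃ (n : ℕ) (B : Fin n → Obj.{u, v, 0} X) (hB : ∀ i, (B i).IsIrreducible),
    A.Isomorphic (Obj.directSum B) ∧ Nat.card {i : Fin n // mk (B i) (hB i) = p} = k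

end Irr

/-- `|X| = |M| |C|`. -/
noncomputable def order (X : CrossedModule G M) : ℕ := Nat.card M * Nat.card X.C

/-- `D = |C| |K|`. -/
noncomputable def D (X : CrossedModule G M) : ℕ := Nat.card X.C * Nat.card X.K

/-- The matrix `S_{pq} = (1/|X|) ∑_{m,n} conj (ψ_p(m, ∂n) ψ_q(n, ∂m))`. -/
noncomputable def S (X : CrossedModule G M) (p q : X.Irr) : ℂ :=
  (1 / (X.order : ℂ)) * ∑ m : M, ∑ n : M, conj (p.ψ m (X.bd n) * q.ψ n (X.bd m))

/-- The matrix square `S²`; the index set `Irr(X)` is finite for a finite crossed module, so the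
`finsum` is the ordinary sum. -/
noncomputable def Ssq (X : CrossedModule G M) (p q : X.Irr) : ℂ :=
  ∑ᶠ r : X.Irr, X.S p r * X.S r q

/-- The row of `p` in `S` is `α` times the row of the trivial object. -/
def RowEq (X : CrossedModule G M) (p : X.Irr) (α : ℂ) : Prop :=
  ∀ q : X.Irr, X.S p q = α * X.S (Irr.one X) q

/-- `p` is transparent: its row in `S` is proportional to the row of the trivial object. -/
def IsTransparent (X : CrossedModule G M) (p : X.Irr) : Prop := ∃ α : ℂ, X.RowEq p α

/-- Bruguières' modularizability condition: whenever the row of `p` is `α` times the row of the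
trivial object, one has `ω_p = 1` and `α = d_p` (in particular `α` is a positive integer). -/
def BruguieresCondition (X : CrossedModule G M) : Prop :=
  ∀ (p : X.Irr) (α : ℂ), X.RowEq p α → p.ω = 1 ∧ α = (p.d : ℂ)

end CrossedModule

universe w''

/-! The triples behave like representations of a finite group: averaging gives complete reducibility
and Schur's lemma holds, so the multiplicity of `p` in `A` is `dim Hom(p, A)`. Two such Hom spaces
are computed by Frobenius reciprocity.

Into the regular object on `M × G`, `Hom(A, regular)` is the dual of `A`. Hence `p` occurs `d_p`
times there, `Irr` is finite, and comparing characters gives `∑ d_p ψ_p(m, g) = |G| δ(g, 1)` and `∑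
d_p² = |M||G|` (`sum_d_mul_ψ`, `sum_d_sq`).

Into the vacuum, `Hom(A, vacuum)` is the dual of the vectors supported on `K` and fixed by `Q(I)`.
The trace of the projector onto them yields `μ_p = |M|⁻¹ ∑ ψ_p(n, ∂m)` over `m ∈ M`, `n ∈ K`
(`mult_vacuum`).

As `S_{1r} = d_r / |X|`, orthogonality collapses `[S²]_{1p}` to this same sum, and `|M| = |K||I|`,
`|G| = |C||I|` turn the constant into `1 / D` (`mult_vacuum_eq_Ssq`). If the row of `p` is `α` times
the trivial row, the column of `1` forces `α = d_p`; then `[S²]_{1p}` is a multiple of `∑ d_r²` and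
`μ_p = d_p > 0`. Conversely, every vector of the vacuum is supported on `K` and fixed by `Q(I)`, a
property inherited by each constituent `p`. So `ψ_p(m, ∂n) = ψ_p(m, 1)` vanishes off `K`, the double
sum for `S_{pq}` factors as `d_p d_q / |X|`, and `ω_p = 1`. -/

theorem LinearMap.trace_pi_comp_proj {ι : Type*} [Fintype ι] {V : ι → Type*}
    [∀ i, AddCommGroup (V i)] [∀ i, Module ℂ (V i)] [∀ i, FiniteDimensional ℂ (V i)]
    (f : ∀ i, V i →ₗ[ℂ] V i) :
    LinearMap.trace ℂ (∀ i, V i) (LinearMap.pi fun i => f i ∘ₗ LinearMap.proj i) =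
      ∑ i, LinearMap.trace ℂ (V i) (f i) := by
  classical
  have h : (LinearMap.pi fun i => f i ∘ₗ LinearMap.proj i) =
      ∑ i, LinearMap.single ℂ V i ∘ₗ f i ∘ₗ LinearMap.proj i := by
    refine LinearMap.ext fun x => funext fun j => ?_
    rw [LinearMap.sum_apply, Finset.sum_apply, Finset.sum_eq_single j]
    · simp
    · intro i _ hij
      simp [Pi.single_eq_of_ne hij.symm]
    · simp
  rw [h, map_sum]
  refine Finset.sum_congr rfl fun i _ => ?_
  -- Cyclicity of the trace reduces each diagonal block to `f i`.
  rw [LinearMap.trace_comp_comm', LinearMap.comp_assoc, LinearMap.proj_comp_single_same,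
    LinearMap.comp_id]

namespace CrossedModule

variable {G : Type u} {M : Type v} [Group G] [Group M] [Fintype M] {X : CrossedModule G M}

namespace Obj

/-! ### Operator identities, morphism spaces and Schur's lemma -/

open scoped Classical in
theorem P_P_apply (A : Obj.{u, v, w} X) (m n : M) (x : A.V) :
    A.P m (A.P n x) = if m = n then A.P m x else 0 := by
  have := LinearMap.congr_fun (A.P_mul_P m n) x
  split_ifs at this ⊢ <;> simpa using this

theorem P_Q_apply (A : Obj.{u, v, w} X) (m : M) (g : G) (x : A.V) :
    A.P m (A.Q g x) = A.Q g (A.P (X.act m g) x) :=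
  LinearMap.congr_fun (A.P_mul_Q m g) x

theorem Q_P_apply (A : Obj.{u, v, w} X) (m : M) (g : G) (x : A.V) :
    A.Q g (A.P m x) = A.P (X.act m g⁻¹) (A.Q g x) := by
  rw [P_Q_apply, ← X.act_mul, inv_mul_cancel, X.act_one]

theorem Q_mul_apply (A : Obj.{u, v, w} X) (g h : G) (x : A.V) :
    A.Q (g * h) x = A.Q g (A.Q h x) := by simp

theorem sum_P_apply (A : Obj.{u, v, w} X) (x : A.V) : ∑ m, A.P m x = x := by
  have := LinearMap.congr_fun A.sum_P x
  simpa [LinearMap.sum_apply] using this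

theorem isMorphism_iff {A : Obj.{u, v, w} X} {B : Obj.{u, v, w'} X} {f : A.V →ₗ[ℂ] B.V} :
    IsMorphism A B f ↔
      (∀ m x, f (A.P m x) = B.P m (f x)) ∧ ∀ g x, f (A.Q g x) = B.Q g (f x) := by
  simp [IsMorphism, LinearMap.ext_iff]

theorem IsMorphism.comp {A : Obj.{u, v, w} X} {B : Obj.{u, v, w'} X} {D : Obj.{u, v, w''} X}
    {f : A.V →ₗ[ℂ] B.V} {g : B.V →ₗ[ℂ] D.V} (hg : IsMorphism B D g) (hf : IsMorphism A B f) :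
    IsMorphism A D (g ∘ₗ f) := by
  rw [isMorphism_iff] at *
  simp [hf, hg]

theorem Isomorphic.comp {A : Obj.{u, v, w} X} {B : Obj.{u, v, w'} X} {D : Obj.{u, v, w''} X}
    (h : A.Isomorphic B) (h' : B.Isomorphic D) : A.Isomorphic D := by
  obtain ⟨f, hf⟩ := h
  obtain ⟨f', hf'⟩ := h'
  exact ⟨f.trans f', hf'.comp hf⟩

/-- The space of morphisms. -/
def homs (A : Obj.{u, v, w} X) (B : Obj.{u, v, w'} X) : Submodule ℂ (A.V →ₗ[ℂ] B.V) where
  carrier := {f | IsMorphism A B f}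
  add_mem' {f g} hf hg := by
    simp only [Set.mem_ofPred_eq, isMorphism_iff] at *
    simp [hf, hg]
  zero_mem' := by simp [isMorphism_iff]
  smul_mem' c f hf := by
    simp only [Set.mem_ofPred_eq, isMorphism_iff] at *
    simp [hf]

/-- Morphisms into isomorphic objects correspond. -/
theorem finrank_homs_congr_right (A : Obj.{u, v, w} X) {B : Obj.{u, v, w'} X}
    {B' : Obj.{u, v, w''} X} (h : B.Isomorphic B') :
    Module.finrank ℂ (homs A B) = Module.finrank ℂ (homs A B') := by
  obtain ⟨e, he⟩ := h
  have he' : IsMorphism B' B e.symm.toLinearMap := by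
    rw [isMorphism_iff] at *
    refine ⟨fun m x => ?_, fun g x => ?_⟩
    · rw [LinearEquiv.coe_coe, LinearEquiv.symm_apply_eq]
      simpa using (he.1 m (e.symm x)).symm
    · rw [LinearEquiv.coe_coe, LinearEquiv.symm_apply_eq]
      simpa using (he.2 g (e.symm x)).symm
  exact LinearEquiv.finrank_eq
    { toFun := fun f => ⟨e.toLinearMap ∘ₗ f.1, he.comp f.2⟩
      invFun := fun f => ⟨e.symm.toLinearMap ∘ₗ f.1, he'.comp f.2⟩
      map_add' := fun f g => by ext; simp
      map_smul' := fun c f => by ext; simp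
      left_inv := fun f => by ext; simp
      right_inv := fun f => by ext; simp }

theorem finrank_homs_directSum (A : Obj.{u, v, w} X) {ι : Type w'} [Fintype ι]
    (B : ι → Obj.{u, v, w''} X) :
    Module.finrank ℂ (homs A (directSum B)) = ∑ i, Module.finrank ℂ (homs A (B i)) := by
  rw [← Module.finrank_pi_fintype]
  exact LinearEquiv.finrank_eq
    { toFun := fun f i => ⟨LinearMap.proj i ∘ₗ f.1, by
        have := isMorphism_iff.1 f.2
        exact isMorphism_iff.2 ⟨fun m x => congrFun (this.1 m x) i,
          fun g x => congrFun (this.2 g x) i⟩⟩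
      invFun := fun f => ⟨LinearMap.pi fun i => (f i).1,
        (isMorphism_iff (B := directSum B) (f := LinearMap.pi fun i => (f i).1)).2
        ⟨fun m x => funext fun i => (isMorphism_iff.1 (f i).2).1 m x,
          fun g x => funext fun i => (isMorphism_iff.1 (f i).2).2 g x⟩⟩
      map_add' := fun f g => rfl
      map_smul' := fun c f => rfl
      left_inv := fun f => rfl
      right_inv := fun f => rfl }

theorem isInvariant_ker {A : Obj.{u, v, w} X} {B : Obj.{u, v, w'} X} {f : A.V →ₗ[ℂ] B.V}
    (hf : IsMorphism A B f) : A.IsInvariant (LinearMap.ker f) := by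
  rw [isMorphism_iff] at hf
  refine ⟨fun m x hx => ?_, fun g x hx => ?_⟩ <;>
    simp_all [LinearMap.mem_ker]

theorem isInvariant_range {A : Obj.{u, v, w} X} {B : Obj.{u, v, w'} X} {f : A.V →ₗ[ℂ] B.V}
    (hf : IsMorphism A B f) : B.IsInvariant (LinearMap.range f) := by
  rw [isMorphism_iff] at hf
  refine ⟨?_, ?_⟩
  · rintro m _ ⟨x, rfl⟩
    exact ⟨_, hf.1 m x⟩
  · rintro g _ ⟨x, rfl⟩
    exact ⟨_, hf.2 g x⟩

theorem IsIrreducible.injective {A : Obj.{u, v, w} X} {B : Obj.{u, v, w'} X}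
    (hA : A.IsIrreducible) {f : A.V →ₗ[ℂ] B.V} (hf : IsMorphism A B f) (h0 : f ≠ 0) :
    Function.Injective f := by
  rcases hA.2 _ (isInvariant_ker hf) with h | h
  · exact LinearMap.ker_eq_bot.1 h
  · exact absurd (LinearMap.ker_eq_top.1 h) h0

theorem IsIrreducible.isomorphic {A : Obj.{u, v, w} X} {B : Obj.{u, v, w'} X}
    (hA : A.IsIrreducible) (hB : B.IsIrreducible) {f : A.V →ₗ[ℂ] B.V} (hf : IsMorphism A B f)
    (h0 : f ≠ 0) : A.Isomorphic B := by
  refine ⟨LinearEquiv.ofBijective f ⟨hA.injective hf h0, ?_⟩, hf⟩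
  rcases hB.2 _ (isInvariant_range hf) with h | h
  · exact absurd (LinearMap.range_eq_bot.1 h) h0
  · exact LinearMap.range_eq_top.1 h

theorem finrank_homs_of_not_isomorphic {A : Obj.{u, v, w} X} {B : Obj.{u, v, w'} X}
    (hA : A.IsIrreducible) (hB : B.IsIrreducible) (h : ¬ A.Isomorphic B) :
    Module.finrank ℂ (homs A B) = 0 := by
  have : homs A B = ⊥ := by
    rw [eq_bot_iff]
    intro f hf
    by_contra h0
    exact h (hA.isomorphic hB hf h0)
  rw [this, finrank_bot]

/-- Schur's lemma: endomorphisms of an irreducible object are scalars. -/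
theorem finrank_homs_self {A : Obj.{u, v, w} X} (hA : A.IsIrreducible) :
    Module.finrank ℂ (homs A A) = 1 := by
  have := hA.1
  have h1 : IsMorphism A A LinearMap.id := by simp [isMorphism_iff]
  refine finrank_eq_one (⟨LinearMap.id, h1⟩ : homs A A) ?_ ?_
  · intro h
    obtain ⟨x, hx⟩ := exists_ne (0 : A.V)
    exact hx (LinearMap.congr_fun (congrArg Subtype.val h) x)
  · rintro ⟨f, hf⟩
    obtain ⟨c, hc⟩ := Module.End.exists_eigenvalue f
    refine ⟨c, Subtype.ext ?_⟩
    -- If nonzero, this endomorphism would be injective, yet it kills an eigenvector.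
    have hm : f - c • LinearMap.id ∈ homs A A :=
      (homs A A).sub_mem hf ((homs A A).smul_mem c h1)
    by_contra hne
    have hinj := hA.injective hm (sub_ne_zero.2 (Ne.symm hne))
    obtain ⟨x, hx⟩ := hc.exists_hasEigenvector
    refine hx.2 (hinj ?_)
    simp [hx.apply_eq_smul]

theorem finrank_homs_of_isomorphic {A : Obj.{u, v, w} X} {B : Obj.{u, v, w'} X}
    (hA : A.IsIrreducible) (h : A.Isomorphic B) : Module.finrank ℂ (homs A B) = 1 := by
  rw [← finrank_homs_congr_right A h, finrank_homs_self hA]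

theorem dim_pos {A : Obj.{u, v, w} X} (hA : A.IsIrreducible) : 0 < A.dim := by
  have := hA.1
  exact Module.finrank_pos

/-! ### Subobjects and transport of structure -/

/-- Restriction of an object to an invariant subspace. -/
def subobj (A : Obj.{u, v, w} X) (W : Submodule ℂ A.V) (hW : A.IsInvariant W) :
    Obj.{u, v, w} X where
  V := W
  P m := (A.P m).restrict (hW.1 m)
  Q :=
    { toFun := fun g => (A.Q g).restrict (hW.2 g)
      map_one' := by ext; simp
      map_mul' := fun g h => by ext; simp }
  P_mul_P m n := by
    ext x
    have := A.P_P_apply m n x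
    split_ifs at this ⊢ <;> simpa using this
  sum_P := by
    ext x
    simpa [LinearMap.sum_apply] using A.sum_P_apply x
  P_mul_Q m g := by
    ext x
    exact A.P_Q_apply m g x

/-- Transport of an object along a linear equivalence. -/
def transport (A : Obj.{u, v, w} X) {V : Type w'} [AddCommGroup V] [Module ℂ V]
    (e : A.V ≃ₗ[ℂ] V) : Obj.{u, v, w'} X where
  V := V
  finiteDimensional := Module.Finite.equiv e
  P m := e.conj (A.P m)
  Q :=
    { toFun := fun g => e.conj (A.Q g)
      map_one' := by ext; simp [LinearEquiv.conj_apply]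
      map_mul' := fun g h => by ext; simp [LinearEquiv.conj_apply] }
  P_mul_P m n := by
    ext x
    have := A.P_P_apply m n (e.symm x)
    split_ifs at this ⊢ <;> simp [LinearEquiv.conj_apply, this]
  sum_P := by
    ext x
    simp [LinearMap.sum_apply, LinearEquiv.conj_apply, ← map_sum, sum_P_apply]
  P_mul_Q m g := by
    ext x
    simp [LinearEquiv.conj_apply, P_Q_apply]

theorem isomorphic_transport (A : Obj.{u, v, w} X) {V : Type w'} [AddCommGroup V] [Module ℂ V]
    (e : A.V ≃ₗ[ℂ] V) : A.Isomorphic (A.transport e) :=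
  ⟨e, isMorphism_iff.2 ⟨fun m x => congrArg (fun y => e (A.P m y)) (e.symm_apply_apply x).symm,
    fun g x => congrArg (fun y => e (A.Q g y)) (e.symm_apply_apply x).symm⟩⟩

/-- Choosing a basis moves summands of objects in any universe into the `Type`-valued objects from
which `Irr` is built. -/
theorem exists_isomorphic_type_zero (A : Obj.{u, v, w} X) :
    ∃ B : Obj.{u, v, 0} X, A.Isomorphic B :=
  ⟨_, A.isomorphic_transport (Module.finBasis ℂ A.V).equivFun⟩

theorem IsIrreducible.congr {A : Obj.{u, v, w} X} {B : Obj.{u, v, w'} X} (hA : A.IsIrreducible)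
    (h : A.Isomorphic B) : B.IsIrreducible := by
  obtain ⟨e, he⟩ := h
  rw [isMorphism_iff] at he
  have := hA.1
  refine ⟨e.symm.toEquiv.nontrivial, fun W hW => ?_⟩
  have hc : A.IsInvariant (W.comap e.toLinearMap) := by
    refine ⟨fun m x hx => ?_, fun g x hx => ?_⟩
    · rw [Submodule.mem_comap, he.1]
      exact hW.1 _ _ hx
    · rw [Submodule.mem_comap, he.2]
      exact hW.2 _ _ hx
  have hm : (W.comap e.toLinearMap).map e.toLinearMap = W :=
    Submodule.map_comap_eq_of_surjective e.surjective W
  rcases hA.2 _ hc with h | h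
  · left
    rw [← hm, h, Submodule.map_bot]
  · right
    rw [← hm, h, Submodule.map_top]
    exact LinearEquiv.range e

/-! ### Complete reducibility by averaging -/

/-- Averaging an endomorphism over all `P(m)`. -/
def averageP (A : Obj.{u, v, w} X) (f : Module.End ℂ A.V) : Module.End ℂ A.V :=
  ∑ m, A.P m * f * A.P m

theorem averageP_apply (A : Obj.{u, v, w} X) (f : Module.End ℂ A.V) (x : A.V) :
    A.averageP f x = ∑ m, A.P m (f (A.P m x)) := by
  simp [averageP, LinearMap.sum_apply]

/-- By orthogonality of the `P(m)`, both sides collapse to `P(n) f P(n)`. -/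
theorem averageP_P (A : Obj.{u, v, w} X) (f : Module.End ℂ A.V) (n : M) (x : A.V) :
    A.averageP f (A.P n x) = A.P n (A.averageP f x) := by
  classical
  simp only [averageP_apply, map_sum, P_P_apply]
  rw [Finset.sum_eq_single n, Finset.sum_eq_single n] <;> simp +contextual [eq_comm]

/-- Averaging an endomorphism over `Q`. -/
noncomputable def averageQ [Fintype G] (A : Obj.{u, v, w} X) (f : Module.End ℂ A.V) :
    Module.End ℂ A.V :=
  (Fintype.card G : ℂ)⁻¹ • ∑ g, A.Q g⁻¹ * f * A.Q g

theorem averageQ_apply [Fintype G] (A : Obj.{u, v, w} X) (f : Module.End ℂ A.V) (x : A.V) :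
    A.averageQ f x = (Fintype.card G : ℂ)⁻¹ • ∑ g, A.Q g⁻¹ (f (A.Q g x)) := by
  simp [averageQ, LinearMap.sum_apply]

theorem averageQ_Q [Fintype G] (A : Obj.{u, v, w} X) (f : Module.End ℂ A.V) (h : G) (x : A.V) :
    A.averageQ f (A.Q h x) = A.Q h (A.averageQ f x) := by
  simp only [averageQ_apply, map_smul, map_sum, ← Q_mul_apply]
  congr 1
  refine Fintype.sum_equiv (Equiv.mulRight h) _ _ fun g => ?_
  simp

/-- Conjugation by `Q(g)` only permutes the `P(n)`, so commuting with all of them survives the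
average over `Q`. -/
theorem averageQ_P [Fintype G] (A : Obj.{u, v, w} X) (f : Module.End ℂ A.V)
    (hf : ∀ n x, f (A.P n x) = A.P n (f x)) (n : M) (x : A.V) :
    A.averageQ f (A.P n x) = A.P n (A.averageQ f x) := by
  simp only [averageQ_apply, map_smul, map_sum, P_Q_apply A n]
  congr 1
  refine Finset.sum_congr rfl fun g _ => ?_
  rw [← hf, P_Q_apply, ← X.act_mul, inv_mul_cancel, X.act_one]

/-- Complete reducibility: an invariant subspace has an invariant complement. -/
theorem IsInvariant.exists_isCompl [Fintype G] {A : Obj.{u, v, w} X} {W : Submodule ℂ A.V}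
    (hW : A.IsInvariant W) : ∃ W' : Submodule ℂ A.V, A.IsInvariant W' ∧ IsCompl W W' := by
  obtain ⟨p, hp⟩ := W.subtype.exists_leftInverse_of_injective W.ker_subtype
  have hp' : ∀ x ∈ W, W.subtype (p x) = x := fun x hx =>
    congrArg Subtype.val (LinearMap.congr_fun hp ⟨x, hx⟩)
  -- Averaging over `P` first and `Q` second makes a linear projection onto `W` a morphism; it still
  -- maps into `W` and fixes `W`, so its kernel is the complement.
  set f := A.averageQ (A.averageP (W.subtype ∘ₗ p)) with hf
  have hmem : ∀ x, f x ∈ W := by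
    intro x
    rw [hf, averageQ_apply]
    refine W.smul_mem _ (W.sum_mem fun g _ => hW.2 _ _ ?_)
    rw [averageP_apply]
    exact W.sum_mem fun m _ => hW.1 _ _ (p _).2
  have hid : ∀ x ∈ W, f x = x := by
    intro x hx
    have h1 : ∀ g, A.averageP (W.subtype ∘ₗ p) (A.Q g x) = A.Q g x := by
      intro g
      rw [averageP_apply]
      conv_rhs => rw [← A.sum_P_apply (A.Q g x)]
      refine Finset.sum_congr rfl fun m _ => ?_
      rw [LinearMap.comp_apply, hp' _ (hW.1 _ _ (hW.2 _ _ hx)), P_P_apply, if_pos rfl]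
    rw [hf, averageQ_apply]
    simp [h1, ← Nat.cast_smul_eq_nsmul ℂ, smul_smul]
  have hmor : IsMorphism A A f :=
    isMorphism_iff.2 ⟨averageQ_P A _ (averageP_P A _), averageQ_Q A _⟩
  refine ⟨LinearMap.ker f, isInvariant_ker hmor, ?_⟩
  have := LinearMap.isCompl_of_proj (f := f.codRestrict W hmem) fun x => Subtype.ext (hid x x.2)
  rwa [LinearMap.ker_codRestrict] at this

/-- The object is a finite direct sum of irreducible objects. -/
def IsDecomposable (A : Obj.{u, v, w} X) : Prop :=
  ∃ (n : ℕ) (B : Fin n → Obj.{u, v, 0} X), (∀ i, (B i).IsIrreducible) ∧ A.Isomorphic (directSum B)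

theorem isDecomposable_of_fintype {A : Obj.{u, v, w} X} {ι : Type} [Fintype ι]
    (B : ι → Obj.{u, v, 0} X) (hB : ∀ i, (B i).IsIrreducible)
    (h : A.Isomorphic (directSum B)) : A.IsDecomposable := by
  let e := (Fintype.equivFin ι).symm
  exact ⟨_, fun i => B (e i), fun i => hB _, h.comp ⟨LinearEquiv.piCongrLeft' ℂ _ e.symm,
    isMorphism_iff.2 ⟨fun m x => rfl, fun g x => rfl⟩⟩⟩

theorem isDecomposable_of_isCompl {A : Obj.{u, v, w} X} {W W' : Submodule ℂ A.V}
    (hW : A.IsInvariant W) (hW' : A.IsInvariant W') (hc : IsCompl W W')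
    (h : (A.subobj W hW).IsDecomposable) (h' : (A.subobj W' hW').IsDecomposable) :
    A.IsDecomposable := by
  obtain ⟨n, B, hB, (e : W ≃ₗ[ℂ] ∀ i, (B i).V), he⟩ := h
  obtain ⟨n', B', hB', (e' : W' ≃ₗ[ℂ] ∀ i, (B' i).V), he'⟩ := h'
  refine isDecomposable_of_fintype (Sum.elim B B') (by rintro (i | i) <;> simp [hB, hB']) ?_
  replace he := isMorphism_iff.1 he
  replace he' := isMorphism_iff.1 he'
  let φ : A.V ≃ₗ[ℂ] ∀ i, (Sum.elim B B' i).V :=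
    (W.prodEquivOfIsCompl W' hc).symm.trans ((e.prodCongr e').trans
      (LinearEquiv.sumPiEquivProdPi ℂ _ _ fun i => (Sum.elim B B' i).V).symm)
  -- With `φ` described on sums, compatibility with `P` and `Q` can be checked one component at a
  -- time.
  have hφ : ∀ (x : W) (x' : W'), φ (x + x' : A.V) = fun i => Sum.rec (e x) (e' x') i := by
    intro x x'
    have : (x + x' : A.V) = W.prodEquivOfIsCompl W' hc (x, x') := by simp
    rw [this]
    simp only [φ, LinearEquiv.trans_apply, LinearEquiv.symm_apply_apply]
    rfl
  refine ⟨φ, isMorphism_iff.2 ⟨fun m y => ?_, fun g y => ?_⟩⟩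
  · obtain ⟨⟨x, x'⟩, rfl⟩ := (W.prodEquivOfIsCompl W' hc).surjective y
    rw [Submodule.coe_prodEquivOfIsCompl', map_add]
    have h1 := hφ ((A.subobj W hW).P m x) ((A.subobj W' hW').P m x')
    refine h1.trans (Eq.trans (funext fun i => ?_)
      (congrArg (fun z => (directSum (Sum.elim B B')).P m z) (hφ x x').symm))
    rcases i with i | i
    · exact congrFun (he.1 m x) i
    · exact congrFun (he'.1 m x') i
  · obtain ⟨⟨x, x'⟩, rfl⟩ := (W.prodEquivOfIsCompl W' hc).surjective y
    rw [Submodule.coe_prodEquivOfIsCompl', map_add]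
    have h1 := hφ ((A.subobj W hW).Q g x) ((A.subobj W' hW').Q g x')
    refine h1.trans (Eq.trans (funext fun i => ?_)
      (congrArg (fun z => (directSum (Sum.elim B B')).Q g z) (hφ x x').symm))
    rcases i with i | i
    · exact congrFun (he.2 g x) i
    · exact congrFun (he'.2 g x') i

theorem isDecomposable [Fintype G] (A : Obj.{u, v, w} X) : A.IsDecomposable := by
  induction hd : A.dim using Nat.strong_induction_on generalizing A with
  | _ d ih =>
    by_cases hn : Nontrivial A.V
    · by_cases hA : A.IsIrreducible
      · obtain ⟨B, hB⟩ := A.exists_isomorphic_type_zero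
        refine isDecomposable_of_fintype (fun _ : Unit => B) (fun _ => hA.congr hB)
          (hB.comp ⟨(LinearEquiv.funUnique Unit ℂ B.V).symm, isMorphism_iff.2
            ⟨fun _ _ => rfl, fun _ _ => rfl⟩⟩)
      · obtain ⟨W, hW, h0, h1⟩ : ∃ W, A.IsInvariant W ∧ W ≠ ⊥ ∧ W ≠ ⊤ := by
          simpa [IsIrreducible, hn] using hA
        obtain ⟨W', hW', hc⟩ := hW.exists_isCompl
        have hsum := Submodule.finrank_add_eq_of_isCompl hc
        have hpos : 0 < Module.finrank ℂ W := by
          rwa [Module.finrank_pos_iff, Submodule.nontrivial_iff_ne_bot]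
        have hlt : Module.finrank ℂ W < Module.finrank ℂ A.V := Submodule.finrank_lt h1
        subst hd
        refine isDecomposable_of_isCompl hW hW' hc (ih _ ?_ _ rfl) (ih _ ?_ _ rfl)
        · exact hlt
        · change Module.finrank ℂ W' < Module.finrank ℂ A.V
          omega
    -- The zero object is the empty direct sum.
    · have := not_nontrivial_iff_subsingleton.1 hn
      have hs : Subsingleton (directSum (Fin.elim0 : Fin 0 → Obj.{u, v, 0} X)).V :=
        inferInstanceAs (Subsingleton (∀ i : Fin 0, ((Fin.elim0 : Fin 0 → Obj.{u, v, 0} X) i).V))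
      exact ⟨0, Fin.elim0, fun i => i.elim0, LinearEquiv.ofSubsingleton _ _, isMorphism_iff.2
        ⟨fun _ _ => Subsingleton.elim _ _, fun _ _ => Subsingleton.elim _ _⟩⟩

theorem character_directSum {ι : Type w'} [Fintype ι] (A : ι → Obj.{u, v, w} X) (m : M) (g : G) :
    (directSum A).character m g = ∑ i, (A i).character m g :=
  LinearMap.trace_pi_comp_proj fun i => (A i).P m * (A i).Q g

theorem sum_character_one (A : Obj.{u, v, w} X) : ∑ m, A.character m 1 = A.dim := by
  simp only [character, map_one, mul_one, ← map_sum, A.sum_P]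
  exact LinearMap.trace_one _ _

end Obj

/-! ### The regular object -/

open scoped Classical in
/-- The regular object: functions on `M × G`, with `(P(m) φ)(x, y) = δ(m, x ^ y) φ(x, y)` and
`(Q(g) φ)(x, y) = φ(x, y g)`. -/
noncomputable def regular [Fintype G] (X : CrossedModule G M) : Obj.{u, v, max u v} X where
  V := M × G → ℂ
  P m :=
    { toFun := fun φ z => if m = X.act z.1 z.2 then φ z else 0
      map_add' := by
        intro φ φ'
        funext z
        by_cases h : m = X.act z.1 z.2 <;> simp [h]
      map_smul' := by
        intro c φ
        funext z
        by_cases h : m = X.act z.1 z.2 <;> simp [h] }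
  Q :=
    { toFun := fun g => LinearMap.funLeft ℂ ℂ fun z => (z.1, z.2 * g)
      map_one' := by
        refine LinearMap.ext fun φ => funext fun z => ?_
        simp [LinearMap.funLeft_apply]
      map_mul' := fun g h => by
        refine LinearMap.ext fun φ => funext fun z => ?_
        simp [LinearMap.funLeft_apply, mul_assoc] }
  P_mul_P m n := by
    refine LinearMap.ext fun φ => funext fun z => ?_
    by_cases h : m = n
    · subst h
      by_cases h' : m = X.act z.1 z.2 <;> simp [h']
    · by_cases h' : m = X.act z.1 z.2
      · have : ¬ n = X.act z.1 z.2 := fun h2 => h (h'.trans h2.symm)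
        simp [h, this]
      · simp [h, h']
  sum_P := by
    refine LinearMap.ext fun φ => funext fun z => ?_
    simp [LinearMap.sum_apply]
  P_mul_Q m g := by
    refine LinearMap.ext fun φ => funext fun z => ?_
    have : X.act m g = X.act z.1 (z.2 * g) ↔ m = X.act z.1 z.2 := by
      rw [X.act_mul]
      exact (X.act_injective g).eq_iff
    simp [LinearMap.funLeft_apply, this]

open scoped Classical in
theorem regular_P [Fintype G] (m : M) (φ : X.regular.V) (z : M × G) :
    X.regular.P m φ z = if m = X.act z.1 z.2 then φ z else 0 := rfl

theorem regular_Q [Fintype G] (g : G) (φ : X.regular.V) (z : M × G) :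
    X.regular.Q g φ z = φ (z.1, z.2 * g) := rfl

-- For `g ≠ 1` the shift `(x, y) ↦ (x, y g)` has no fixed point, so the diagonal vanishes; for `g =
-- 1` each `y` contributes the single `x` with `x ^ y = m`.
open scoped Classical in
theorem character_regular [Fintype G] (m : M) (g : G) :
    X.regular.character m g = if g = 1 then (Fintype.card G : ℂ) else 0 := by
  let f : (M × G → ℂ) →ₗ[ℂ] M × G → ℂ := X.regular.P m * X.regular.Q g
  have hf : ∀ φ z, f φ z = if m = X.act z.1 z.2 then φ (z.1, z.2 * g) else 0 :=
    fun φ z => regular_P m (X.regular.Q g φ) z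
  change LinearMap.trace ℂ (M × G → ℂ) f = _
  rw [LinearMap.trace_eq_matrix_trace ℂ (Pi.basisFun ℂ (M × G)), Matrix.trace]
  simp only [Matrix.diag_apply, LinearMap.toMatrix_apply, Pi.basisFun_apply, Pi.basisFun_repr, hf]
  by_cases hg : g = 1
  · subst hg
    simp only [mul_one, Prod.mk.eta, Pi.single_eq_same, if_true]
    rw [Fintype.sum_prod_type_right]
    have : ∀ y : G, ∑ x : M, (if m = X.act x y then (1 : ℂ) else 0) = 1 := by
      intro y
      have h : ∀ x, m = X.act x y ↔ x = X.act m y⁻¹ := by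
        intro x
        constructor
        · rintro rfl
          rw [← X.act_mul, mul_inv_cancel, X.act_one]
        · rintro rfl
          rw [← X.act_mul, inv_mul_cancel, X.act_one]
      simp [h]
    simp [this]
  · rw [if_neg hg]
    refine Finset.sum_eq_zero fun z _ => ?_
    rw [Pi.single_eq_of_ne]
    · simp
    · intro h
      exact hg (by simpa using congrArg Prod.snd h)

namespace Obj

/-- Morphisms to the regular object are linear functionals. -/
theorem finrank_homs_regular [Fintype G] (A : Obj.{u, v, w} X) :
    Module.finrank ℂ (homs A X.regular) = A.dim := by
  rw [dim, ← Subspace.dual_finrank_eq (V := A.V)]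
  have hP : ∀ (f : homs A X.regular) m a, f.1 (A.P m a) = X.regular.P m (f.1 a) :=
    fun f => (isMorphism_iff.1 f.2).1
  have hQ : ∀ (f : homs A X.regular) g a, f.1 (A.Q g a) = X.regular.Q g (f.1 a) :=
    fun f => (isMorphism_iff.1 f.2).2
  let ev : M → X.regular.V →ₗ[ℂ] ℂ := fun m =>
    (LinearMap.proj (m, 1) : (M × G → ℂ) →ₗ[ℂ] ℂ)
  have hev : ∀ m φ, ev m φ = φ (m, 1) := fun _ _ => rfl
  -- Frobenius reciprocity: a morphism is determined by the sum of its values at the points `(m,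
  -- 1)`, since `P` isolates one `m` and `Q` translates `1` to any `y`.
  let F : Module.Dual ℂ A.V → A.V →ₗ[ℂ] X.regular.V := fun l =>
    (LinearMap.pi fun z => l ∘ₗ A.P z.1 ∘ₗ A.Q z.2 : A.V →ₗ[ℂ] (M × G → ℂ))
  have hF : ∀ (l : Module.Dual ℂ A.V) (a : A.V) (z : M × G), F l a z = l (A.P z.1 (A.Q z.2 a)) :=
    fun _ _ _ => rfl
  refine LinearEquiv.finrank_eq
    { toFun := fun f => ∑ m, ev m ∘ₗ f.1
      invFun := fun l => ⟨F l, isMorphism_iff.2 ⟨fun m a => ?_, fun g a => ?_⟩⟩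
      map_add' := fun f g => ?_
      map_smul' := fun c f => ?_
      left_inv := fun f => Subtype.ext (LinearMap.ext fun a => ?_)
      right_inv := fun l => LinearMap.ext fun a => ?_ }
  · ext a
    simp [Finset.sum_add_distrib]
  · ext a
    simp [Finset.mul_sum]
  · classical
    refine funext fun z => ?_
    rw [regular_P, hF, hF, Q_P_apply, P_P_apply]
    have : z.1 = X.act m z.2⁻¹ ↔ m = X.act z.1 z.2 := by
      constructor
      · intro h
        rw [h, ← X.act_mul, inv_mul_cancel, X.act_one]
      · rintro rfl
        rw [← X.act_mul, mul_inv_cancel, X.act_one]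
    rw [apply_ite l, map_zero]
    simp only [this]
  · refine funext fun z => ?_
    rw [regular_Q, hF, hF, Q_mul_apply]
  · classical
    refine funext fun z => ?_
    rw [hF, LinearMap.sum_apply, Finset.sum_eq_single z.1]
    · rw [LinearMap.comp_apply, hev, hP, regular_P, hQ, regular_Q]
      simp [X.act_one]
    · intro m _ hm
      rw [LinearMap.comp_apply, hev, hP, regular_P, if_neg]
      simpa [X.act_one] using hm.symm
    · simp
  · rw [LinearMap.sum_apply]
    have : ∀ m, (ev m ∘ₗ F l) a = l (A.P m a) := by
      intro m
      rw [LinearMap.comp_apply, hev, hF]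
      simp
    simp only [this]
    rw [← map_sum, sum_P_apply]

end Obj

/-! ### The vacuum and the fixed vectors -/

open scoped Classical in
theorem vacuum_P [Fintype G] (m : M) (φ : X.vacuum.V) (z : X.K × X.C) :
    X.vacuum.P m φ z = if m = X.actC z.1 z.2 then φ z else 0 := rfl

theorem vacuum_Q [Fintype G] (g : G) (φ : X.vacuum.V) (z : X.K × X.C) :
    X.vacuum.Q g φ z = φ (z.1, z.2 * (g : X.C)) := rfl

namespace Obj

/-- The vectors supported on `ker ∂` and fixed by `im ∂`. -/
def fixed (A : Obj.{u, v, w} X) : Submodule ℂ A.V where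
  carrier := {x | (∀ m, X.bd m ≠ 1 → A.P m x = 0) ∧ ∀ n, A.Q (X.bd n) x = x}
  add_mem' {x y} hx hy :=
    ⟨fun m hm => by simp [hx.1 m hm, hy.1 m hm], fun n => by simp [hx.2 n, hy.2 n]⟩
  zero_mem' := ⟨fun m _ => map_zero _, fun n => map_zero _⟩
  smul_mem' c x hx := ⟨fun m hm => by simp [hx.1 m hm], fun n => by simp [hx.2 n]⟩

theorem mem_fixed {A : Obj.{u, v, w} X} {x : A.V} :
    x ∈ A.fixed ↔ (∀ m, X.bd m ≠ 1 → A.P m x = 0) ∧ ∀ n, A.Q (X.bd n) x = x := Iff.rfl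

open scoped Classical in
/-- The projection onto the vectors supported on `ker ∂` and fixed by `im ∂`. -/
noncomputable def fixedProj (A : Obj.{u, v, w} X) : A.V →ₗ[ℂ] A.V :=
  (Fintype.card M : ℂ)⁻¹ • ∑ m, ∑ n, if X.bd n = 1 then A.P n * A.Q (X.bd m) else 0

open scoped Classical in
theorem fixedProj_apply (A : Obj.{u, v, w} X) (x : A.V) :
    A.fixedProj x =
      (Fintype.card M : ℂ)⁻¹ • ∑ m, ∑ n, if X.bd n = 1 then A.P n (A.Q (X.bd m) x) else 0 := by
  simp only [fixedProj, LinearMap.smul_apply, LinearMap.sum_apply]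
  congr 1
  refine Finset.sum_congr rfl fun m _ => Finset.sum_congr rfl fun n _ => ?_
  split_ifs <;> simp

/-- `im ∂` acts trivially on `ker ∂`, by the second crossed module axiom. -/
theorem Q_P_of_bd_eq_one (A : Obj.{u, v, w} X) {k : M} (hk : X.bd k = 1) (n : M) (x : A.V) :
    A.Q (X.bd n) (A.P k x) = A.P k (A.Q (X.bd n) x) := by
  rw [P_Q_apply, X.act_bd_of_mem_K (MonoidHom.mem_ker.2 hk)]

open scoped Classical in
theorem sum_P_of_mem_fixed {A : Obj.{u, v, w} X} {x : A.V} (hx : x ∈ A.fixed) :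
    ∑ n, (if X.bd n = 1 then A.P n x else 0) = x := by
  conv_rhs => rw [← A.sum_P_apply x]
  refine Finset.sum_congr rfl fun n _ => ?_
  split_ifs with h
  · rfl
  · rw [(mem_fixed.1 hx).1 n h]

/-- Orthogonality of the `P(n)` gives the support condition. Invariance follows by translating the
average over `M`, because `Q(∂k)` commutes with `P(n)` for `n ∈ K`. -/
theorem isProj_fixedProj (A : Obj.{u, v, w} X) : LinearMap.IsProj A.fixed A.fixedProj where
  map_mem x := by
    classical
    refine mem_fixed.2 ⟨fun k hk => ?_, fun k => ?_⟩
    · simp only [fixedProj_apply, map_smul, map_sum]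
      rw [Finset.sum_eq_zero, smul_zero]
      refine fun m _ => Finset.sum_eq_zero fun n _ => ?_
      split_ifs with h
      · rw [P_P_apply, if_neg]
        rintro rfl
        exact hk h
      · exact map_zero _
    · simp only [fixedProj_apply, map_smul, map_sum]
      congr 1
      refine Fintype.sum_equiv (Equiv.mulLeft k) _ _ fun m => Finset.sum_congr rfl fun n _ => ?_
      split_ifs with h
      · rw [Q_P_of_bd_eq_one A h, ← Q_mul_apply, ← map_mul]
        rfl
      · exact map_zero _
  map_id x hx := by
    classical
    simp only [fixedProj_apply, (mem_fixed.1 hx).2, sum_P_of_mem_fixed hx]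
    simp [← Nat.cast_smul_eq_nsmul ℂ, smul_smul]

theorem fixedProj_Q (A : Obj.{u, v, w} X) (k : M) (x : A.V) :
    A.fixedProj (A.Q (X.bd k) x) = A.fixedProj x := by
  simp only [fixedProj_apply]
  congr 1
  refine Fintype.sum_equiv (Equiv.mulRight k) _ _ fun m => Finset.sum_congr rfl fun n _ => ?_
  simp only [Equiv.coe_mulRight, map_mul, Module.End.mul_apply]

theorem IsMorphism.map_fixedProj {A : Obj.{u, v, w} X} {B : Obj.{u, v, w'} X}
    {f : A.V →ₗ[ℂ] B.V} (hf : IsMorphism A B f) (x : A.V) :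
    f (A.fixedProj x) = B.fixedProj (f x) := by
  rw [isMorphism_iff] at hf
  simp only [fixedProj_apply, map_smul, map_sum]
  congr 1
  refine Finset.sum_congr rfl fun m _ => Finset.sum_congr rfl fun n _ => ?_
  rw [apply_ite f, map_zero, hf.1, hf.2]

-- The rank of a projector is its trace.
open scoped Classical in
theorem finrank_fixed (A : Obj.{u, v, w} X) :
    (Module.finrank ℂ A.fixed : ℂ) = (Fintype.card M : ℂ)⁻¹ *
      ∑ m, ∑ n, if X.bd n = 1 then A.character n (X.bd m) else 0 := by
  rw [← A.isProj_fixedProj.trace, fixedProj, map_smul, smul_eq_mul, map_sum]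
  congr 1
  refine Finset.sum_congr rfl fun m _ => ?_
  rw [map_sum]
  refine Finset.sum_congr rfl fun n _ => ?_
  split_ifs
  · rfl
  · exact map_zero _

/-- The labels `x ^ y` lie in `K`, and `Q(g)` depends only on the coset of `g` in `C`. -/
theorem mem_fixed_vacuum [Fintype G] (φ : X.vacuum.V) : φ ∈ X.vacuum.fixed := by
  classical
  refine mem_fixed.2 ⟨fun m hm => ?_, fun n => ?_⟩
  · refine funext fun z => ?_
    rw [vacuum_P, if_neg]
    · rfl
    · rintro rfl
      obtain ⟨x, c⟩ := z
      induction c using QuotientGroup.induction_on with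
      | H y => exact hm (MonoidHom.mem_ker.1 (X.act_mem_K x.2 y))
  · refine funext fun z => ?_
    have : ((X.bd n : G) : X.C) = 1 := (QuotientGroup.eq_one_iff _).2 ⟨n, rfl⟩
    rw [vacuum_Q, this, mul_one]

/-- This makes `y ↦ fixedProj (P(x) Q(y) a)` a function on `C`: an element of `I` moves past `P(x)`
and is absorbed by the projection. -/
theorem fixedProj_P_Q_congr (A : Obj.{u, v, w} X) {x : M} (hx : X.bd x = 1) {g h : G}
    (hgh : (g : X.C) = (h : X.C)) (a : A.V) :
    A.fixedProj (A.P x (A.Q g a)) = A.fixedProj (A.P x (A.Q h a)) := by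
  obtain ⟨n, hn⟩ : g * h⁻¹ ∈ X.I := by
    rw [← QuotientGroup.eq_one_iff, QuotientGroup.mk_mul, hgh, QuotientGroup.mk_inv,
      mul_inv_cancel]
  have hg : g = X.bd n * h := by rw [hn, inv_mul_cancel_right]
  rw [hg, Q_mul_apply, ← Q_P_of_bd_eq_one A hx, fixedProj_Q]

/-- Morphisms to the vacuum are functionals on the fixed vectors. -/
theorem finrank_homs_vacuum [Fintype G] (A : Obj.{u, v, w} X) :
    Module.finrank ℂ (homs A X.vacuum) = Module.finrank ℂ A.fixed := by
  classical
  rw [← Subspace.dual_finrank_eq (V := A.fixed)]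
  have hP : ∀ (f : homs A X.vacuum) m a, f.1 (A.P m a) = X.vacuum.P m (f.1 a) :=
    fun f => (isMorphism_iff.1 f.2).1
  have hQ : ∀ (f : homs A X.vacuum) g a, f.1 (A.Q g a) = X.vacuum.Q g (f.1 a) :=
    fun f => (isMorphism_iff.1 f.2).2
  have hK : ∀ x : X.K, X.bd (x : M) = 1 := fun x => MonoidHom.mem_ker.1 x.2
  let ev : X.K → X.vacuum.V →ₗ[ℂ] ℂ := fun x =>
    (LinearMap.proj (x, 1) : (X.K × X.C → ℂ) →ₗ[ℂ] ℂ)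
  have hev : ∀ x φ, ev x φ = φ (x, 1) := fun _ _ => rfl
  let e : A.V →ₗ[ℂ] A.fixed := A.fixedProj.codRestrict A.fixed A.isProj_fixedProj.map_mem
  have he : ∀ x : X.K, ∀ g h : G, (g : X.C) = h → ∀ a,
      e (A.P x (A.Q g a)) = e (A.P x (A.Q h a)) :=
    fun x g h hgh a => Subtype.ext (A.fixedProj_P_Q_congr (hK x) hgh a)
  -- The coset representative `out` is immaterial by `he`.
  let F : Module.Dual ℂ A.fixed → A.V →ₗ[ℂ] X.vacuum.V := fun l =>
    (LinearMap.pi fun z => l ∘ₗ e ∘ₗ A.P z.1 ∘ₗ A.Q z.2.out : A.V →ₗ[ℂ] (X.K × X.C → ℂ))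
  have hF : ∀ (l : Module.Dual ℂ A.fixed) (a : A.V) (x : X.K) (g : G),
      F l a (x, (g : X.C)) = l (e (A.P x (A.Q g a))) := fun l a x g =>
    congrArg l (he x _ _ (QuotientGroup.out_eq' _) a)
  refine LinearEquiv.finrank_eq
    { toFun := fun f => (∑ x, ev x ∘ₗ f.1) ∘ₗ A.fixed.subtype
      invFun := fun l => ⟨F l, isMorphism_iff.2 ⟨fun m a => ?_, fun g a => ?_⟩⟩
      map_add' := fun f g => ?_
      map_smul' := fun c f => ?_
      left_inv := fun f => Subtype.ext (LinearMap.ext fun a => ?_)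
      right_inv := fun l => LinearMap.ext fun a => ?_ }
  · ext a
    simp [Finset.sum_add_distrib]
  · ext a
    simp [Finset.mul_sum]
  · refine funext fun ⟨x, c⟩ => ?_
    induction c using QuotientGroup.induction_on with
    | H y =>
      rw [vacuum_P, hF, hF, Q_P_apply, P_P_apply, X.actC_mk]
      have : x = X.act m y⁻¹ ↔ m = X.act x y := by
        constructor
        · intro h
          rw [h, ← X.act_mul, inv_mul_cancel, X.act_one]
        · rintro rfl
          rw [← X.act_mul, mul_inv_cancel, X.act_one]
      rw [apply_ite e, map_zero, apply_ite l, map_zero]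
      simp only [this]
  · refine funext fun ⟨x, c⟩ => ?_
    induction c using QuotientGroup.induction_on with
    | H y => rw [vacuum_Q, hF, ← QuotientGroup.mk_mul, hF, Q_mul_apply]
  · refine funext fun ⟨x, c⟩ => ?_
    induction c using QuotientGroup.induction_on with
    | H y =>
      rw [hF, LinearMap.comp_apply, LinearMap.sum_apply]
      -- Morphisms intertwine the projections, and the vacuum's projection is the identity.
      have h1 : f.1 (A.fixed.subtype (e (A.P x (A.Q y a)))) = f.1 (A.P x (A.Q y a)) :=
        (f.2.map_fixedProj _).trans (X.vacuum.isProj_fixedProj.map_id _ (mem_fixed_vacuum _))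
      have hone : ∀ x' : X.K, X.actC x' 1 = x' := fun x' => X.act_one x'
      rw [Finset.sum_eq_single x]
      · rw [LinearMap.comp_apply, h1, hev, hP, vacuum_P, hQ, vacuum_Q]
        simp [hone]
      · intro m _ hm
        rw [LinearMap.comp_apply, h1, hev, hP, vacuum_P, if_neg]
        rw [hone]
        exact fun h => hm (Subtype.ext h.symm)
      · simp
  · rw [LinearMap.comp_apply, LinearMap.sum_apply]
    have h1 : ∀ x : X.K, (ev x ∘ₗ F l) (A.fixed.subtype a) = l (e (A.P x a)) := by
      intro x
      rw [LinearMap.comp_apply, hev, ← QuotientGroup.mk_one, hF]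
      simp
    simp only [h1]
    rw [← map_sum, ← map_sum]
    have h2 : ∑ x : X.K, A.P x a = (a : A.V) := by
      rw [← Finset.sum_subtype (s := Finset.univ.filter fun n => X.bd n = 1)
        (by simp [MonoidHom.mem_ker]) (fun n => A.P n a), Finset.sum_filter]
      exact sum_P_of_mem_fixed a.2
    rw [h2]
    exact congrArg l (Subtype.ext (A.isProj_fixedProj.map_id _ a.2))

end Obj

/-! ### Cardinalities and multiplicities -/

theorem dim_vacuum [Fintype G] : X.vacuum.dim = X.D := by
  classical
  change Module.finrank ℂ (X.K × X.C → ℂ) = _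
  rw [Module.finrank_fintype_fun_eq_card, D, ← Nat.card_eq_fintype_card, Nat.card_prod, mul_comm]

theorem card_eq_card_ker_mul_card_range [Fintype G] (X : CrossedModule G M) :
    Fintype.card M = Nat.card X.K * Nat.card X.I := by
  rw [← Subgroup.index_ker, mul_comm, Subgroup.index_mul_card, Nat.card_eq_fintype_card]

theorem card_eq_card_coker_mul_card_range {N : Type w} [Group N] [Fintype G]
    (X : CrossedModule G N) :
    Fintype.card G = Nat.card X.C * Nat.card X.I := by
  rw [← Subgroup.card_eq_card_quotient_mul_card_subgroup, Nat.card_eq_fintype_card]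

namespace Obj

/-- By Schur's lemma each summand contributes 1 or 0 to the Hom space, so the count does not depend
on the decomposition. -/
theorem IsIrreducible.finrank_homs_eq_card {ι : Type} [Fintype ι] {A : Obj.{u, v, 0} X}
    (hA : A.IsIrreducible) (B : ι → Obj.{u, v, 0} X) (hB : ∀ i, (B i).IsIrreducible)
    {D : Obj.{u, v, w} X} (h : D.Isomorphic (directSum B)) :
    Module.finrank ℂ (homs A D) = Nat.card {i // Irr.mk (B i) (hB i) = Irr.mk A hA} := by
  classical
  rw [finrank_homs_congr_right A h, finrank_homs_directSum, Nat.card_eq_fintype_card,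
    Fintype.card_subtype, Finset.card_filter]
  refine Finset.sum_congr rfl fun i _ => ?_
  have hiff : Irr.mk (B i) (hB i) = Irr.mk A hA ↔ (B i).Isomorphic A :=
    Quotient.eq (r := X.irrSetoid)
  split_ifs with hi
  · exact finrank_homs_of_isomorphic hA (hiff.1 hi).symm
  · exact finrank_homs_of_not_isomorphic hA (hB i) fun h => hi (hiff.2 h.symm)

end Obj

/-! ### Irreducible classes and orthogonality -/

namespace Irr

open Obj

/-- The multiplicity of `p` in `A`. -/
noncomputable def mult (p : X.Irr) (A : Obj.{u, v, w} X) : ℕ :=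
  Module.finrank ℂ (homs (Quotient.out p).1 A)

theorem occursTimes_iff [Fintype G] (p : X.Irr) (A : Obj.{u, v, w} X) (k : ℕ) :
    p.OccursTimes A k ↔ k = p.mult A := by
  have key : ∀ (n : ℕ) (B : Fin n → Obj.{u, v, 0} X) (hB : ∀ i, (B i).IsIrreducible),
      A.Isomorphic (directSum B) → Nat.card {i // mk (B i) (hB i) = p} = p.mult A := by
    intro n B hB h
    have hp : mk p.out.1 p.out.2 = p := Quotient.out_eq p
    rw [mult, p.out.2.finrank_homs_eq_card B hB h, hp]
  constructor
  · rintro ⟨n, B, hB, h, rfl⟩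
    exact key n B hB h
  · rintro rfl
    obtain ⟨n, B, hB, h⟩ := A.isDecomposable
    exact ⟨n, B, hB, h, key n B hB h⟩

theorem d_pos (p : X.Irr) : 0 < p.d := by
  obtain ⟨⟨A, hA⟩, rfl⟩ := Quotient.exists_rep p
  exact dim_pos hA

theorem sum_ψ_one (p : X.Irr) : ∑ m, p.ψ m 1 = p.d := by
  obtain ⟨⟨A, hA⟩, rfl⟩ := Quotient.exists_rep p
  exact A.sum_character_one

open scoped Classical in
theorem one_ψ (m : M) (g : G) : (one X).ψ m g = if m = 1 then 1 else 0 := by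
  change X.trivialObj.character m g = _
  have h : X.trivialObj.P m * X.trivialObj.Q g = if m = 1 then LinearMap.id else 0 := by
    change (if m = 1 then (1 : Module.End ℂ ℂ) else 0) * 1 = _
    rw [mul_one]
    split_ifs <;> rfl
  rw [Obj.character, h]
  split_ifs
  · rw [LinearMap.trace_id]
    change ((Module.finrank ℂ ℂ : ℕ) : ℂ) = 1
    simp
  · exact map_zero _

theorem exists_regular_decomposition [Fintype G] (X : CrossedModule G M) :
    ∃ (n : ℕ) (B : Fin n → X.Irr), (∀ p : X.Irr, Nat.card {i // B i = p} = p.d) ∧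
      ∀ m g, ∑ i, (B i).ψ m g = X.regular.character m g := by
  obtain ⟨n, B, hB, h⟩ := X.regular.isDecomposable
  refine ⟨n, fun i => mk (B i) (hB i), fun p => ?_, fun m g => ?_⟩
  · obtain ⟨⟨A, hA⟩, rfl⟩ := Quotient.exists_rep p
    exact (hA.finrank_homs_eq_card B hB h).symm.trans A.finrank_homs_regular
  · rw [h.character_eq, character_directSum]
    rfl

/-- Every class occurs `d_p > 0` times in the finite decomposition of the regular object. -/
instance instFinite [Fintype G] : Finite X.Irr := by
  obtain ⟨n, B, hB, -⟩ := exists_regular_decomposition X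
  refine Finite.of_surjective B fun p => ?_
  have h : 0 < Nat.card {i // B i = p} := by
    rw [hB]
    exact p.d_pos
  obtain ⟨i⟩ := (Nat.card_pos_iff.1 h).1
  exact ⟨i.1, i.2⟩

open scoped Classical in
/-- Column orthogonality with the identity. -/
theorem sum_d_mul_ψ [Fintype G] [Fintype X.Irr] (m : M) (g : G) :
    ∑ p : X.Irr, (p.d : ℂ) * p.ψ m g = if g = 1 then (Fintype.card G : ℂ) else 0 := by
  obtain ⟨n, B, hB, hψ⟩ := exists_regular_decomposition X
  -- Summands of the regular object are grouped by class; class `p` has `d_p` of them.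
  rw [← character_regular (X := X), ← hψ, ← Finset.sum_fiberwise (s := Finset.univ) (g := B)]
  refine Finset.sum_congr rfl fun p _ => ?_
  rw [Finset.sum_congr rfl (g := fun _ => p.ψ m g)
    (fun i hi => by rw [(Finset.mem_filter.1 hi).2]), Finset.sum_const, nsmul_eq_mul, ← hB p,
    Nat.card_eq_fintype_card, Fintype.card_subtype]

/-- Writing one factor `d_p` as `∑ ψ_p(m, 1)` reduces this to orthogonality at `g = 1`. -/
theorem sum_d_sq [Fintype G] [Fintype X.Irr] :
    ∑ p : X.Irr, (p.d : ℂ) * p.d = Fintype.card M * Fintype.card G := by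
  classical
  have : ∀ p : X.Irr, (p.d : ℂ) * p.d = ∑ m, p.d * p.ψ m 1 := fun p => by
    rw [← Finset.mul_sum, sum_ψ_one]
  simp only [this]
  rw [Finset.sum_comm]
  simp [sum_d_mul_ψ]

open scoped Classical in
theorem mult_vacuum [Fintype G] (p : X.Irr) :
    (p.mult X.vacuum : ℂ) = (Fintype.card M : ℂ)⁻¹ *
      ∑ m, ∑ n, if X.bd n = 1 then p.ψ n (X.bd m) else 0 := by
  rw [mult, finrank_homs_vacuum, finrank_fixed]
  have : p.out.1.character = p.ψ := by
    conv_rhs => rw [← Quotient.out_eq p]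
    rfl
  rw [this]

theorem isConstituent_of_mult_pos {p : X.Irr} {A : Obj.{u, v, w} X} (h : 0 < p.mult A) :
    p.IsConstituent A := by
  obtain ⟨⟨f, hf⟩, hne⟩ := Module.finrank_pos_iff_exists_ne_zero.1 h
  exact ⟨p.out.1, p.out.2, Quotient.out_eq p, f, hf,
    p.out.2.injective hf fun h0 => hne (Subtype.ext h0)⟩

/-- Both conditions hold on the whole vacuum and pull back along an injective morphism. -/
theorem IsConstituent.fixed_eq_top [Fintype G] {p : X.Irr} (h : p.IsConstituent X.vacuum) :
    ∃ (B : Obj.{u, v, 0} X) (hB : B.IsIrreducible), mk B hB = p ∧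
      (∀ m, X.bd m ≠ 1 → B.P m = 0) ∧ ∀ n, B.Q (X.bd n) = 1 := by
  obtain ⟨B, hB, hp, f, hf, hinj⟩ := h
  rw [isMorphism_iff] at hf
  refine ⟨B, hB, hp, fun m hm => LinearMap.ext fun x => hinj ?_,
    fun n => LinearMap.ext fun x => hinj ?_⟩
  · rw [hf.1, (mem_fixed.1 (mem_fixed_vacuum (f x))).1 m hm]
    exact (map_zero f).symm
  · rw [hf.2, (mem_fixed.1 (mem_fixed_vacuum (f x))).2 n]
    rfl

theorem IsConstituent.ψ_bd [Fintype G] {p : X.Irr} (h : p.IsConstituent X.vacuum) (m n : M) :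
    p.ψ m (X.bd n) = p.ψ m 1 := by
  obtain ⟨B, hB, rfl, -, hQ⟩ := h.fixed_eq_top
  change B.character m (X.bd n) = B.character m 1
  rw [character, character, hQ, map_one]

theorem IsConstituent.ψ_eq_zero [Fintype G] {p : X.Irr} (h : p.IsConstituent X.vacuum) {m : M}
    (hm : X.bd m ≠ 1) (g : G) : p.ψ m g = 0 := by
  obtain ⟨B, hB, rfl, hP, -⟩ := h.fixed_eq_top
  change B.character m g = 0
  rw [character, hP m hm, zero_mul, map_zero]

theorem IsConstituent.ω_eq_one [Fintype G] {p : X.Irr} (h : p.IsConstituent X.vacuum) :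
    p.ω = 1 := by
  have : (p.d : ℂ) ≠ 0 := Nat.cast_ne_zero.2 p.d_pos.ne'
  simp only [ω, h.ψ_bd, sum_ψ_one]
  exact one_div_mul_cancel this

end Irr

/-! ### The matrix `S` and transparency -/

open Irr

theorem order_ne_zero [Fintype G] (X : CrossedModule G M) : (X.order : ℂ) ≠ 0 := by
  rw [Nat.cast_ne_zero, order]
  exact (Nat.mul_pos Nat.card_pos Nat.card_pos).ne'

theorem S_comm (p q : X.Irr) : X.S p q = X.S q p := by
  rw [S, S, Finset.sum_comm]
  simp only [mul_comm]

theorem S_one (q : X.Irr) : X.S (one X) q = (X.order : ℂ)⁻¹ * q.d := by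
  classical
  rw [S, one_div]
  congr 1
  rw [Finset.sum_eq_single 1]
  · simp only [one_ψ, map_one, if_true, one_mul]
    rw [← map_sum, sum_ψ_one, Complex.conj_natCast]
  · intro m _ hm
    simp [one_ψ, hm]
  · simp

theorem rowEq_of_isConstituent [Fintype G] {p : X.Irr} (h : p.IsConstituent X.vacuum) :
    X.RowEq p p.d := by
  intro q
  rw [S_one, S, one_div, mul_left_comm]
  congr 1
  have : ∀ m n, conj (p.ψ m (X.bd n) * q.ψ n (X.bd m)) = conj (p.ψ m 1) * conj (q.ψ n 1) := by
    intro m n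
    rw [h.ψ_bd, map_mul]
    -- Off `K` both sides vanish, so `∂m` may be replaced by 1 in the second factor too.
    by_cases hm : X.bd m = 1
    · rw [hm]
    · rw [h.ψ_eq_zero hm, map_zero, zero_mul, zero_mul]
  simp only [this, ← Finset.mul_sum, ← Finset.sum_mul, ← map_sum, sum_ψ_one, Complex.conj_natCast]

/-- Compare the entries in the column of the trivial object. -/
theorem RowEq.eq_d [Fintype G] {p : X.Irr} {α : ℂ} (h : X.RowEq p α) : α = p.d := by
  have h1 := h (one X)
  have hd : ((one X).d : ℂ) = 1 := by
    classical
    rw [← sum_ψ_one]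
    simp [one_ψ]
  rw [S_comm, S_one, S_one, hd, mul_one, mul_comm] at h1
  exact (mul_right_cancel₀ (inv_ne_zero X.order_ne_zero) h1).symm

theorem mult_vacuum_eq_Ssq [Fintype G] (p : X.Irr) :
    (p.mult X.vacuum : ℂ) = (X.D : ℂ) * X.Ssq (one X) p := by
  classical
  have := Fintype.ofFinite X.Irr
  have hsum : ∑ r : X.Irr, (r.d : ℂ) * ∑ m, ∑ n, conj (r.ψ m (X.bd n) * p.ψ n (X.bd m)) =
      Fintype.card G * conj (∑ m, ∑ n, if X.bd n = 1 then p.ψ n (X.bd m) else 0) := by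
    simp only [map_sum, Finset.mul_sum]
    rw [Finset.sum_comm]
    refine Finset.sum_congr rfl fun m _ => ?_
    rw [Finset.sum_comm]
    refine Finset.sum_congr rfl fun n _ => ?_
    have h := congrArg conj (sum_d_mul_ψ (X := X) m (X.bd n))
    simp only [map_sum, map_mul, Complex.conj_natCast] at h
    simp only [map_mul, ← mul_assoc, ← Finset.sum_mul, h]
    split_ifs <;> simp
  -- A multiplicity is real, so its formula may be conjugated to match the one coming from `S`.
  have hmult := congrArg conj (mult_vacuum p)
  rw [map_mul, map_inv₀, Complex.conj_natCast, Complex.conj_natCast] at hmult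
  rw [hmult, Ssq, finsum_eq_sum_of_fintype]
  have hM : (Fintype.card M : ℂ) ≠ 0 := Nat.cast_ne_zero.2 Fintype.card_ne_zero
  have hterm : ∀ r : X.Irr, X.S (one X) r * X.S r p = ((X.order : ℂ)⁻¹ * (X.order : ℂ)⁻¹) *
      ((r.d : ℂ) * ∑ m, ∑ n, conj (r.ψ m (X.bd n) * p.ψ n (X.bd m))) := by
    intro r
    rw [S_one, S]
    ring
  simp only [hterm]
  rw [← Finset.mul_sum, hsum, ← mul_assoc, ← mul_assoc]
  congr 1
  have hK : (Nat.card X.K : ℂ) ≠ 0 := Nat.cast_ne_zero.2 Nat.card_pos.ne'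
  have hI : (Nat.card X.I : ℂ) ≠ 0 := Nat.cast_ne_zero.2 Nat.card_pos.ne'
  have hC : (Nat.card X.C : ℂ) ≠ 0 := Nat.cast_ne_zero.2 Nat.card_pos.ne'
  -- What remains is `|M|⁻¹ = D |G| / |X|²`.
  rw [order, D, Nat.card_eq_fintype_card (α := M), X.card_eq_card_ker_mul_card_range,
    X.card_eq_card_coker_mul_card_range]
  push_cast
  field_simp

/-- Here `D [S²]_{1p} = D |X|⁻² d_p ∑ d_r² = d_p`, because `D |M||G| = |X|²`. -/
theorem RowEq.mult_vacuum [Fintype G] {p : X.Irr} {α : ℂ} (h : X.RowEq p α) :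
    p.mult X.vacuum = p.d := by
  have := Fintype.ofFinite X.Irr
  have hα := h.eq_d
  subst hα
  have hterm : ∀ r : X.Irr, X.S (one X) r * X.S r p =
      ((X.order : ℂ)⁻¹ * (X.order : ℂ)⁻¹ * p.d) * ((r.d : ℂ) * r.d) := by
    intro r
    rw [S_comm r p, h r, S_one]
    ring
  have hK : (Nat.card X.K : ℂ) ≠ 0 := Nat.cast_ne_zero.2 Nat.card_pos.ne'
  have hI : (Nat.card X.I : ℂ) ≠ 0 := Nat.cast_ne_zero.2 Nat.card_pos.ne'
  have hC : (Nat.card X.C : ℂ) ≠ 0 := Nat.cast_ne_zero.2 Nat.card_pos.ne'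
  have key : (p.mult X.vacuum : ℂ) = p.d := by
    rw [mult_vacuum_eq_Ssq, Ssq, finsum_eq_sum_of_fintype]
    simp only [hterm]
    rw [← Finset.mul_sum, sum_d_sq, order, D, Nat.card_eq_fintype_card (α := M),
      X.card_eq_card_ker_mul_card_range, X.card_eq_card_coker_mul_card_range]
    push_cast
    field_simp
  exact_mod_cast key

theorem RowEq.mult_vacuum_pos [Fintype G] {p : X.Irr} {α : ℂ} (h : X.RowEq p α) :
    0 < p.mult X.vacuum := by
  rw [h.mult_vacuum]
  exact p.d_pos

theorem RowEq.isConstituent [Fintype G] {p : X.Irr} {α : ℂ} (h : X.RowEq p α) :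
    p.IsConstituent X.vacuum :=
  isConstituent_of_mult_pos h.mult_vacuum_pos

end CrossedModule

theorem mainTheorem8 {G : Type u} {M : Type v} [Group G] [Group M] [Fintype G] [Fintype M]
    (X : CrossedModule G M) :
    Finite X.Irr ∧ X.vacuum.dim = X.D ∧
    ∃ μ : X.Irr → ℕ,
      -- `μ p` is the (well-defined) multiplicity of `p` in the vacuum
      (∀ (p : X.Irr) (k : ℕ), p.OccursTimes X.vacuum k ↔ k = μ p) ∧
      (∀ p : X.Irr, (μ p : ℂ) = (X.D : ℂ) * X.Ssq (CrossedModule.Irr.one X) p) ∧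
      (∀ p : X.Irr, 0 < μ p ↔ ∃ α : ℂ, X.RowEq p α) ∧
      (∀ (p : X.Irr) (α : ℂ), X.RowEq p α → α = (μ p : ℂ) ∧ μ p = p.d ∧ p.ω = 1) ∧
      {p : X.Irr | X.IsTransparent p} = {p : X.Irr | p.IsConstituent X.vacuum} ∧
      X.BruguieresCondition := by
  refine ⟨inferInstance, X.dim_vacuum, fun p => p.mult X.vacuum,
    fun p k => p.occursTimes_iff _ k, CrossedModule.mult_vacuum_eq_Ssq, fun p => ⟨fun h => ?_, ?_⟩,
    fun p α h => ⟨?_, h.mult_vacuum, h.isConstituent.ω_eq_one⟩, ?_,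
    fun p α h => ⟨h.isConstituent.ω_eq_one, h.eq_d⟩⟩
  · exact ⟨_, CrossedModule.rowEq_of_isConstituent
      (CrossedModule.Irr.isConstituent_of_mult_pos h)⟩
  · rintro ⟨α, h⟩
    exact h.mult_vacuum_pos
  · change α = (p.mult X.vacuum : ℂ)
    rw [h.mult_vacuum, h.eq_d]
  · ext p
    exact ⟨fun ⟨_, h⟩ => h.isConstituent,
      fun h => ⟨_, CrossedModule.rowEq_of_isConstituent h⟩⟩
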